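/- **Setting.** Featherweight Java expressions are $e ::= x \mid \mathtt{this} \mid e.f \mid e.m(\overline e) \mid \mathtt{new}\ C(\overline e) \mid (C)e$, and a method declaration is $M = C_0\ m(\overline C\ \overline x)\{\mathtt{return}\ e\}$. A *class table* $CT$ is a finite set of clauses $C\ \mathtt{extends}\ D$, $C.\mathit{init}(\overline D)$, $C.f:D$, $C.m:\overline D\to D$. Put $\mathrm{ext}(CT)=\{(C,D) : (C\ \mathtt{extends}\ D)\in CT\}$. For a finite binary relation $\Sigma$ on class names, $<:_\Sigma$ is its reflexive transitive closure; under $CT$, $<:$ means $<:_{\mathrm{ext}(CT)}$. **Contextual typing.** $\mathrm{extends}(C,CT)=D$ means $(C\ \mathtt{extends}\ D)\in CT$; $\mathrm{fields}(C,CT)=C.\mathit{init}(\overline D)$ means that this constructor clause is in $CT$; $\mathrm{field}(f,C,CT)$ and $\mathrm{mtype}(m,C,CT)$ are given by the clause for $f$, resp. $m$, of $C$ itself if there is one, and otherwise by lookup in a direct superclass of $C$. The judgment $\Gamma;CT\vdash e:C$ is given by the usual rules: variables and $\mathtt{this}$ by lookup in $\Gamma$; $e.f$ by $\mathrm{field}$;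 $e.m(\overline e)$ by $\mathrm{mtype}$ and $\mathtt{new}\ C(\overline e)$ by $\mathrm{fields}$, the argument types being subtypes of the parameter types; and $(C)e$ has type $C$ for $e:D$ by an upcast ($D<:C$), a downcast ($C<:D$, $C\neq D$) or a stupid cast (neither is a subtype of the other). The method $M$ *is OK in $C$ under $CT$* if $\overline x:\overline C,\mathtt{this}:C;CT\vdash e:E_0$ with $E_0<:C_0$, and for some $D$ with $\mathrm{extends}(C,CT)=D$: whenever $\mathrm{mtype}(m,D,CT)=\overline D\to D_0$, then $\overline D=\overline C$ and $D_0=C_0$. **Co-contextual typing.** A class type $T$ is a class name (*ground*) or one of countably many class variables $U$. Constraints are $T=T'$, $T\ne T'$, $T<:T'$, $T\not<:T'$, and $T=T'\ \mathrm{if}\ \mathit{cond}$, where a condition is a finite set (conjunction) of equations and inequations of class types. Class table requirements $CR$ are finite sets of pairs $(\mathit{CReq},\mathit{cond})$ with $\mathit{CReq}$ of the form $T.\mathtt{extends}:T'$, $T.\mathit{init}(\overline T)$, $T.f:T'$, $T.m:\overline T\to T'$ or optional $(T.m:\overline T\to T')_{opt}$. Two requirements *overlap* if both are $\mathtt{extends}$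 requirements, both are constructor requirements, both concern the same field name, or both concern the same method name (optional or not). $\mathrm{merge}_{CR}(CR_1,CR_2)=CR|_S$ keeps the requirements that overlap with none of the other set; for each overlapping pair $(r_1,c_1)\in CR_1$, $(r_2,c_2)\in CR_2$ with receivers $T_1,T_2$ it has $(r_1,c_1\cup\{T_1\neq T_2\})$, $(r_2,c_2\cup\{T_1\neq T_2\})$ and $(r_1,c_1\cup c_2\cup\{T_1=T_2\})$ in $CR$ (with $r_2$ in place of $r_1$ in the last if $r_1$ is optional and $r_2$ is not), and in $S$ the constraints that the signatures of $r_1,r_2$ are equal if $T_1=T_2$ (sequences of different lengths being unequal). Context requirements $R$ are finite partial maps from variables and $\mathtt{this}$ to class types; $\mathrm{merge}_R$ takes their (left-biased) union, with the constraints $R_1(x)=R_2(x)$ for $x$ in both domains. More than two arguments are merged successively. The judgment $e:T\mid S\mid R\mid CR$ is given by the following rules, in which all introduced class variables are fresh, independent subderivations use disjoint class variables, and the constraints of the subderivations and of all merges are included in $S$; the requirements of the subderivations are merged. - $x$ (or $\mathtt{this}$) has type a fresh $U$, with $R=\{x:U\}$ and $S=CR=\emptyset$. - $e.f$ has type a fresh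 $U$, and $(T_e.f:U,\emptyset)$ is merged into $CR_e$. - $e.m(\overline e)$ has type a fresh $U'$, for fresh $\overline U$; $(T_e.m:\overline U\to U',\emptyset)$ is merged in and the constraints $\overline T<:\overline U$ are added. - $\mathtt{new}\ C(\overline e)$ has type $C$, for fresh $\overline U$; $(C.\mathit{init}(\overline U),\emptyset)$ is merged in and $\overline T<:\overline U$ are added. - $(C)e$ has type $C$, adding $\{T_e<:C\}$, or $\{C<:T_e,\ C\neq T_e\}$, or $\{C\not<:T_e,\ T_e\not<:C\}$. The method $M$ *is OK co-contextually with $(S,T,CR)$* if $e:T_e\mid S_e\mid R_e\mid CR_e$, the domain of $R_e$ consists of $\mathtt{this}$ and parameters in $\overline x$ at most, $T=U_c$ for distinct fresh $U_c,U_d$, $CR|_{S_{cr}}=\mathrm{merge}_{CR}(CR_e,(U_c.\mathtt{extends}:U_d,\emptyset),(U_d.m:\overline C\to C_0,\emptyset)_{opt})$, and $S=S_e\cup\{T_e<:C_0\}\cup\{U_c=R_e(\mathtt{this})\mid\mathtt{this}\in\mathrm{dom}\,R_e\}\cup S_{cr}\cup\{C_i=R_e(x_i)\mid x_i\in\mathrm{dom}\,R_e\}$.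 **Solutions and satisfaction.** A substitution $\sigma$ maps class variables to class types. $\mathrm{solve}(\Sigma,S)=\sigma$ means that $\sigma$ satisfies every constraint in $S$, with $<:$ read as $<:_\Sigma$ on class names. $\sigma$ is *ground* for $(T,CR)$ if all class types in $\sigma(T)$ and $\sigma(CR)$, conditions included, are ground. $CT$ *satisfies* $\sigma(CR)$ if for every $(\mathit{CReq},\mathit{cond})\in\sigma(CR)$ whose condition holds: $\mathrm{extends}(C,CT)=D$ for $C.\mathtt{extends}:D$; $\mathrm{fields}(C,CT)=C.\mathit{init}(\overline D)$ for $C.\mathit{init}(\overline D)$; $\mathrm{field}(f,C,CT)=D$ for $C.f:D$; $\mathrm{mtype}(m,C,CT)=\overline D\to D$ for $C.m:\overline D\to D$; and for $(C.m:\overline D\to D)_{opt}$, if $m$ has a type $\mathrm{mtype}(m,C,CT)$ at all, then it is $\overline D\to D$. **Theorem.** Let $M$ be a method declaration that is OK co-contextually with $(S,T,CR)$, let $\Sigma$ be a finite binary relation on class names, and let $\sigma$ be a substitution with $\mathrm{solve}(\Sigma,S)=\sigma$ that is ground for $(T,CR)$. Assume that $\Sigma$ contains the immediate subclass relations that are required,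 that is, $(C,D)\in\Sigma$ for every requirement $(C.\mathtt{extends}:D,\mathit{cond})\in\sigma(CR)$ whose condition holds. Then there exist a class name $C$ and a class table $CT$, with at most one constructor clause for each class, at most one clause for each field of a class and at most one clause for each method of a class, such that $\mathrm{ext}(CT)=\Sigma$, $M$ is OK in $C$ under $CT$, $\sigma(T)=C$, and $CT$ satisfies $\sigma(CR)$. -/

import Mathlib

namespace CoFJ

/-! ### Names, types and syntax -/

abbrev ClassName := String
abbrev FieldName := String
abbrev MethodName := String
abbrev VarName := String

/-- Class variables: countably many, with decidable equality. -/
abbrev ClassVar := ℕ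

/-- Class types: class names (the ground types) or class variables. -/
inductive Ty where
  | cls (C : ClassName)
  | var (U : ClassVar)
  deriving DecidableEq

/-- What a context binds: the self reference or a method parameter. -/
inductive Ref where
  | this
  | param (x : VarName)
  deriving DecidableEq

/-- Featherweight Java expressions. -/
inductive Expr where
  | ref (x : Ref)
  | field (e : Expr) (f : FieldName)
  | invk (e : Expr) (m : MethodName) (es : List Expr)
  | new (C : ClassName) (es : List Expr)
  | cast (C : ClassName) (e : Expr)

/-- A method declaration `ret name(params) { return body; }`. -/
structure MethodDecl where
  ret : ClassName
  name : MethodName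
  params : List (VarName × ClassName)
  body : Expr

/-- The annotated parameter types of a method. -/
def MethodDecl.paramTypes (M : MethodDecl) : List ClassName := M.params.map Prod.snd

/-! ### Class tables and contextual Featherweight Java -/

/-- Class table clauses. -/
inductive Clause where
  | ext (C D : ClassName)
  | ctor (C : ClassName) (Ds : List ClassName)
  | field (C : ClassName) (f : FieldName) (D : ClassName)
  | meth (C : ClassName) (m : MethodName) (Ds : List ClassName) (D : ClassName)
  deriving DecidableEq

/-- A class table is a finite set of clauses. -/
abbrev ClassTable := Finset Clause

/-- A finite immediate-subclass relation: `(C, D)` says that `C` directly extends `D`. -/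
abbrev SubclassRel := Finset (ClassName × ClassName)

/-- The extends clauses of a single clause, as a relation. -/
def Clause.ext? : Clause → SubclassRel
  | .ext C D => {(C, D)}
  | _ => ∅

/-- The immediate-subclass relation of a class table. -/
def ClassTable.extRel (CT : ClassTable) : SubclassRel := CT.biUnion Clause.ext?

/-- Each constructor, each field of a class and each method of a class has at most one clause.
Uniqueness of the direct superclass is a property of `CT.extRel` alone. -/
structure ClassTable.Consistent (CT : ClassTable) : Prop where
  ctor : ∀ C Ds Ds', Clause.ctor C Ds ∈ CT → Clause.ctor C Ds' ∈ CT → Ds = Ds'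
  field : ∀ C f D D', Clause.field C f D ∈ CT → Clause.field C f D' ∈ CT → D = D'
  meth : ∀ C m Ds Ds' D D', Clause.meth C m Ds D ∈ CT → Clause.meth C m Ds' D' ∈ CT →
    Ds = Ds' ∧ D = D'

/-- Subtyping relative to a subclass relation: its reflexive transitive closure. -/
def IsSubtype (Sg : SubclassRel) : ClassName → ClassName → Prop :=
  Relation.ReflTransGen (fun C D => (C, D) ∈ Sg)

/-- `extends(C, CT) = D`. -/
def Extends (CT : ClassTable) (C D : ClassName) : Prop := Clause.ext C D ∈ CT

/-- `fields(C, CT) = C.init(Ds)`: the constructor signature of `C`. -/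
def Fields (CT : ClassTable) (C : ClassName) (Ds : List ClassName) : Prop :=
  Clause.ctor C Ds ∈ CT

/-- `field(f, C, CT) = D`: the declaration of `f` in the nearest superclass of `C`. -/
inductive FieldLookup (CT : ClassTable) (f : FieldName) : ClassName → ClassName → Prop
  | here {C D : ClassName} : Clause.field C f D ∈ CT → FieldLookup CT f C D
  | up {C C' D : ClassName} : (∀ E, Clause.field C f E ∉ CT) → Extends CT C C' →
      FieldLookup CT f C' D → FieldLookup CT f C D

/-- `mtype(m, C, CT) = Ds → D`: the declaration of `m` in the nearest superclass of `C`. -/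
inductive MType (CT : ClassTable) (m : MethodName) :
    ClassName → List ClassName → ClassName → Prop
  | here {C : ClassName} {Ds : List ClassName} {D : ClassName} :
      Clause.meth C m Ds D ∈ CT → MType CT m C Ds D
  | up {C C' : ClassName} {Ds : List ClassName} {D : ClassName} :
      (∀ Es E, Clause.meth C m Es E ∉ CT) → Extends CT C C' →
      MType CT m C' Ds D → MType CT m C Ds D

/-- Typing contexts. -/
abbrev Ctx := Ref → Option ClassName

/-- Expression typing of Featherweight Java, `Γ; CT ⊢ e : C`. -/
inductive HasType (CT : ClassTable) (Γ : Ctx) : Expr → ClassName → Prop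
  | ref {x : Ref} {C : ClassName} : Γ x = some C → HasType CT Γ (.ref x) C
  | field {e : Expr} {f : FieldName} {Ce C : ClassName} :
      HasType CT Γ e Ce → FieldLookup CT f Ce C → HasType CT Γ (.field e f) C
  | invk {e : Expr} {m : MethodName} {es : List Expr} {Ce C : ClassName}
      {Cs Ds : List ClassName} :
      HasType CT Γ e Ce →
      es.length = Cs.length → (∀ p ∈ es.zip Cs, HasType CT Γ p.1 p.2) →
      MType CT m Ce Ds C → List.Forall₂ (IsSubtype CT.extRel) Cs Ds →
      HasType CT Γ (.invk e m es) C
  | new {C : ClassName} {es : List Expr} {Cs Ds : List ClassName} :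
      es.length = Cs.length → (∀ p ∈ es.zip Cs, HasType CT Γ p.1 p.2) →
      Fields CT C Ds → List.Forall₂ (IsSubtype CT.extRel) Cs Ds →
      HasType CT Γ (.new C es) C
  | ucast {C D : ClassName} {e : Expr} :
      HasType CT Γ e D → IsSubtype CT.extRel D C → HasType CT Γ (.cast C e) C
  | dcast {C D : ClassName} {e : Expr} :
      HasType CT Γ e D → IsSubtype CT.extRel C D → C ≠ D → HasType CT Γ (.cast C e) C
  | scast {C D : ClassName} {e : Expr} :
      HasType CT Γ e D → ¬ IsSubtype CT.extRel C D → ¬ IsSubtype CT.extRel D C →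
      HasType CT Γ (.cast C e) C

/-- The context binding the parameters of `M` and `this`. -/
def MethodDecl.ctx (M : MethodDecl) (C : ClassName) : Ctx
  | .this => some C
  | .param x => M.params.lookup x

/-- Method typing of Featherweight Java: `C; CT ⊢ M OK`. -/
def MethodOK (CT : ClassTable) (C : ClassName) (M : MethodDecl) : Prop :=
  ∃ E₀ D : ClassName,
    HasType CT (M.ctx C) M.body E₀ ∧ IsSubtype CT.extRel E₀ M.ret ∧
    Extends CT C D ∧
    ∀ Ds D₀, MType CT M.name D Ds D₀ → M.paramTypes = Ds ∧ M.ret = D₀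

/-! ### Constraints, conditions and requirements -/

/-- Atomic conditions. -/
inductive CondAtom where
  | eq (t t' : Ty)
  | neq (t t' : Ty)
  deriving DecidableEq

/-- A condition is a finite conjunction of atomic conditions. -/
abbrev Cond := Finset CondAtom

/-- Constraints on class types. -/
inductive Constraint where
  | eq (t t' : Ty)
  | neq (t t' : Ty)
  | sub (t t' : Ty)
  | nsub (t t' : Ty)
  | eqIf (t t' : Ty) (c : Cond)

/-- Class requirements: superclass, constructor, field, method and optional method. -/
inductive CReq where
  | ext (t t' : Ty)
  | ctor (t : Ty) (ts : List Ty)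
  | field (t : Ty) (f : FieldName) (t' : Ty)
  | meth (t : Ty) (m : MethodName) (ts : List Ty) (t' : Ty)
  | optMeth (t : Ty) (m : MethodName) (ts : List Ty) (t' : Ty)
  deriving DecidableEq

/-- Class table requirements: a finite set of conditional class requirements. -/
abbrev ClassReqs := Finset (CReq × Cond)

/-- Context requirements: required types of parameters and of `this`. -/
abbrev CtxReqs := Ref → Option Ty

/-! ### Merging -/

/-- The constraint that two context requirements agree where both are defined. -/
def mergeRConstraints (R₁ R₂ : CtxReqs) : Set Constraint :=
  {s | ∃ x t₁ t₂, R₁ x = some t₁ ∧ R₂ x = some t₂ ∧ s = .eq t₁ t₂}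

/-- The union of two context requirements, which takes the first entry where both are defined. -/
def mergeR (R₁ R₂ : CtxReqs) : CtxReqs := fun x => (R₁ x).or (R₂ x)

/-- Iterated merging of context requirements, starting from `R`. -/
def mergeRFrom (R : CtxReqs) : List CtxReqs → CtxReqs × Set Constraint
  | [] => (R, ∅)
  | R' :: Rs =>
      ((mergeRFrom (mergeR R R') Rs).1,
        mergeRConstraints R R' ∪ (mergeRFrom (mergeR R R') Rs).2)

def mergeRs (Rs : List CtxReqs) : CtxReqs × Set Constraint := mergeRFrom (fun _ => none) Rs

/-- The receiver of a class requirement. -/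
def CReq.recv : CReq → Ty
  | .ext t _ => t
  | .ctor t _ => t
  | .field t _ _ => t
  | .meth t _ _ _ => t
  | .optMeth t _ _ _ => t

/-- Which entry of the receiver a class requirement is about. -/
inductive MemberKey where
  | ext
  | ctor
  | field (f : FieldName)
  | meth (m : MethodName)
  deriving DecidableEq

/-- Optional and ordinary requirements on a method concern the same entry. -/
def CReq.key : CReq → MemberKey
  | .ext _ _ => .ext
  | .ctor _ _ => .ctor
  | .field _ f _ => .field f
  | .meth _ m _ _ => .meth m
  | .optMeth _ m _ _ => .meth m

/-- The required signature, as the sequence of its types, the result type coming first. -/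
def CReq.signature : CReq → List Ty
  | .ext _ t' => [t']
  | .ctor _ ts => ts
  | .field _ _ t' => [t']
  | .meth _ _ ts t' => t' :: ts
  | .optMeth _ _ ts t' => t' :: ts

/-- `ts = ts' if t = t'` for sequences. Sequences of different lengths are never equal, so for
these the constraint says `t ≠ t'`. -/
def seqEqIf (ts ts' : List Ty) (t t' : Ty) : Set Constraint :=
  if ts.length = ts'.length then
    {s | ∃ p ∈ ts.zip ts', s = .eqIf p.1 p.2 {.eq t t'}}
  else {.neq t t'}

/-- The requirement that remains of two requirements with the same entry and equal receivers:
the first one, except that an ordinary method requirement prevails over an optional one. -/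
def CReq.keep : CReq → CReq → CReq
  | .optMeth _ _ _ _, .meth t m ts t' => .meth t m ts t'
  | r, _ => r

/-- What two overlapping conditional requirements become by merging. -/
def mergePair (a b : CReq × Cond) : ClassReqs :=
  {(a.1, insert (.neq a.1.recv b.1.recv) a.2),
   (b.1, insert (.neq a.1.recv b.1.recv) b.2),
   (a.1.keep b.1, insert (.eq a.1.recv b.1.recv) (a.2 ∪ b.2))}

/-- Merging of class table requirements: requirements on an entry that does not occur on the other
side are kept, overlapping ones are merged pairwise. -/
def mergeCR (A B : ClassReqs) : ClassReqs :=
  A.filter (fun a => ∀ b ∈ B, a.1.key ≠ b.1.key) ∪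
  B.filter (fun b => ∀ a ∈ A, a.1.key ≠ b.1.key) ∪
  ((A ×ˢ B).filter (fun p => p.1.1.key = p.2.1.key)).biUnion (fun p => mergePair p.1 p.2)

/-- The constraints generated by merging class table requirements. -/
def mergeCRConstraints (A B : ClassReqs) : Set Constraint :=
  {s | ∃ a ∈ A, ∃ b ∈ B, a.1.key = b.1.key ∧
    s ∈ seqEqIf a.1.signature b.1.signature a.1.recv b.1.recv}

/-- Iterated merging of class table requirements, starting from `A`. -/
def mergeCRFrom (A : ClassReqs) : List ClassReqs → ClassReqs × Set Constraint
  | [] => (A, ∅)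
  | B :: Bs =>
      ((mergeCRFrom (mergeCR A B) Bs).1,
        mergeCRConstraints A B ∪ (mergeCRFrom (mergeCR A B) Bs).2)

def mergeCRs (CRs : List ClassReqs) : ClassReqs × Set Constraint := mergeCRFrom ∅ CRs

/-! ### Co-contextual typing -/

/-- The output of co-contextual expression typing, `e : T | S | R | CR`. The set `vars` consists of
the class variables introduced in the derivation. Source expressions contain no class variables, so
a class variable is fresh for a derivation if and only if it is not in `vars`. -/
structure Output where
  ty : Ty
  cons : Set Constraint
  reqs : CtxReqs
  creqs : ClassReqs
  vars : Finset ClassVar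

/-- The class variables introduced in a sequence of derivations. -/
def allVars (os : List Output) : Finset ClassVar := os.foldr (fun o V => o.vars ∪ V) ∅

/-- The union of the constraints of a sequence of derivations. -/
def allCons (os : List Output) : Set Constraint := {s | ∃ o ∈ os, s ∈ o.cons}

/-- The derivations introduce pairwise disjoint sets of class variables. -/
def Independent (os : List Output) : Prop := os.Pairwise (fun o o' => Disjoint o.vars o'.vars)

/-- The constraints that the types of the arguments are subtypes of the variables `Us`. -/
def argCons (os : List Output) (Us : List ClassVar) : Set Constraint :=
  {s | ∃ p ∈ os.zip Us, s = .sub p.1.ty (.var p.2)}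

/-- Co-contextual expression typing. -/
inductive CoExpr : Expr → Output → Prop
  | ref {x : Ref} {U : ClassVar} :
      CoExpr (.ref x)
        { ty := .var U, cons := ∅, reqs := fun y => if y = x then some (.var U) else none,
          creqs := ∅, vars := {U} }
  | field {e : Expr} {f : FieldName} {o : Output} {U : ClassVar} :
      CoExpr e o → U ∉ o.vars →
      CoExpr (.field e f)
        { ty := .var U
          cons := o.cons ∪ (mergeCRs [o.creqs, {(.field o.ty f (.var U), ∅)}]).2
          reqs := o.reqs
          creqs := (mergeCRs [o.creqs, {(.field o.ty f (.var U), ∅)}]).1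
          vars := insert U o.vars }
  | invk {e : Expr} {m : MethodName} {es : List Expr} {o : Output} {os : List Output}
      {U' : ClassVar} {Us : List ClassVar} {crs : List ClassReqs} :
      CoExpr e o →
      es.length = os.length → (∀ p ∈ es.zip os, CoExpr p.1 p.2) →
      Independent (o :: os) →
      Us.length = es.length → (U' :: Us).Nodup → (∀ U ∈ U' :: Us, U ∉ allVars (o :: os)) →
      crs = o.creqs :: {(CReq.meth o.ty m (Us.map Ty.var) (.var U'), ∅)} ::
        os.map Output.creqs →
      CoExpr (.invk e m es)
        { ty := .var U'
          cons := allCons os ∪ o.cons ∪ argCons os Us ∪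
            (mergeRs (o.reqs :: os.map Output.reqs)).2 ∪ (mergeCRs crs).2
          reqs := (mergeRs (o.reqs :: os.map Output.reqs)).1
          creqs := (mergeCRs crs).1
          vars := allVars (o :: os) ∪ (U' :: Us).toFinset }
  | new {C : ClassName} {es : List Expr} {os : List Output} {Us : List ClassVar}
      {crs : List ClassReqs} :
      es.length = os.length → (∀ p ∈ es.zip os, CoExpr p.1 p.2) →
      Independent os →
      Us.length = es.length → Us.Nodup → (∀ U ∈ Us, U ∉ allVars os) →
      crs = {(CReq.ctor (.cls C) (Us.map Ty.var), ∅)} :: os.map Output.creqs →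
      CoExpr (.new C es)
        { ty := .cls C
          cons := allCons os ∪ argCons os Us ∪
            (mergeRs (os.map Output.reqs)).2 ∪ (mergeCRs crs).2
          reqs := (mergeRs (os.map Output.reqs)).1
          creqs := (mergeCRs crs).1
          vars := allVars os ∪ Us.toFinset }
  | ucast {C : ClassName} {e : Expr} {o : Output} :
      CoExpr e o →
      CoExpr (.cast C e)
        { o with ty := .cls C, cons := o.cons ∪ {.sub o.ty (.cls C)} }
  | dcast {C : ClassName} {e : Expr} {o : Output} :
      CoExpr e o →
      CoExpr (.cast C e)
        { o with ty := .cls C, cons := o.cons ∪ {.sub (.cls C) o.ty} ∪ {.neq (.cls C) o.ty} }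
  | scast {C : ClassName} {e : Expr} {o : Output} :
      CoExpr e o →
      CoExpr (.cast C e)
        { o with ty := .cls C, cons := o.cons ∪ {.nsub (.cls C) o.ty} ∪ {.nsub o.ty (.cls C)} }

/-- The constraints that the annotated parameter types agree with the required ones. -/
def paramCons (M : MethodDecl) (R : CtxReqs) : Set Constraint :=
  {s | ∃ p ∈ M.params, ∃ t, R (.param p.1) = some t ∧ s = .eq (.cls p.2) t}

/-- The constraint that the enclosing class agrees with the required type of `this`. -/
def thisCons (Uc : ClassVar) (R : CtxReqs) : Set Constraint :=
  {s | ∃ t, R .this = some t ∧ s = .eq (.var Uc) t}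

/-- Co-contextual method typing, `M OK | S | T | CR`. -/
inductive CoMethod : MethodDecl → Set Constraint → Ty → ClassReqs → Prop
  | intro {M : MethodDecl} {o : Output} {Uc Ud : ClassVar} {crs : List ClassReqs} :
      CoExpr M.body o →
      (∀ x, o.reqs (.param x) ≠ none → x ∈ M.params.map Prod.fst) →
      Uc ∉ o.vars → Ud ∉ o.vars → Uc ≠ Ud →
      crs = [o.creqs, {(CReq.ext (.var Uc) (.var Ud), ∅)},
        {(CReq.optMeth (.var Ud) M.name (M.paramTypes.map Ty.cls) (.cls M.ret), ∅)}] →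
      CoMethod M
        (o.cons ∪ {.sub o.ty (.cls M.ret)} ∪ thisCons Uc o.reqs ∪ (mergeCRs crs).2 ∪
          paramCons M o.reqs)
        (.var Uc) (mergeCRs crs).1

/-! ### Substitutions and solutions -/

/-- Substitutions; a variable without a binding is mapped to itself. -/
abbrev Subst := ClassVar → Ty

def Ty.subst (σ : Subst) : Ty → Ty
  | .cls C => .cls C
  | .var U => σ U

def CondAtom.subst (σ : Subst) : CondAtom → CondAtom
  | .eq t t' => .eq (t.subst σ) (t'.subst σ)
  | .neq t t' => .neq (t.subst σ) (t'.subst σ)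

def Cond.subst (σ : Subst) (c : Cond) : Cond := c.image (CondAtom.subst σ)

def CReq.subst (σ : Subst) : CReq → CReq
  | .ext t t' => .ext (t.subst σ) (t'.subst σ)
  | .ctor t ts => .ctor (t.subst σ) (ts.map (Ty.subst σ))
  | .field t f t' => .field (t.subst σ) f (t'.subst σ)
  | .meth t m ts t' => .meth (t.subst σ) m (ts.map (Ty.subst σ)) (t'.subst σ)
  | .optMeth t m ts t' => .optMeth (t.subst σ) m (ts.map (Ty.subst σ)) (t'.subst σ)

def ClassReqs.subst (σ : Subst) (CR : ClassReqs) : ClassReqs :=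
  CR.image (fun r => (r.1.subst σ, Cond.subst σ r.2))

def Ty.Ground (t : Ty) : Prop := ∃ C, t = .cls C

def CondAtom.Ground : CondAtom → Prop
  | .eq t t' => t.Ground ∧ t'.Ground
  | .neq t t' => t.Ground ∧ t'.Ground

def CReq.Ground (r : CReq) : Prop := r.recv.Ground ∧ ∀ t ∈ r.signature, t.Ground

def ClassReqs.Ground (CR : ClassReqs) : Prop :=
  ∀ r ∈ CR, r.1.Ground ∧ ∀ a ∈ r.2, a.Ground

def CondAtom.Holds : CondAtom → Prop
  | .eq t t' => t = t'
  | .neq t t' => t ≠ t'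

def Cond.Holds (c : Cond) : Prop := ∀ a ∈ c, a.Holds

/-- Subtyping of class types: both are class names that are in the subtype relation. -/
def Ty.Sub (Sg : SubclassRel) (t t' : Ty) : Prop :=
  ∃ C D, t = .cls C ∧ t' = .cls D ∧ IsSubtype Sg C D

/-- Constraint satisfaction. -/
def Sat (Sg : SubclassRel) (σ : Subst) : Constraint → Prop
  | .eq t t' => t.subst σ = t'.subst σ
  | .neq t t' => t.subst σ ≠ t'.subst σ
  | .sub t t' => Ty.Sub Sg (t.subst σ) (t'.subst σ)
  | .nsub t t' => ¬ Ty.Sub Sg (t.subst σ) (t'.subst σ)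
  | .eqIf t t' c => Cond.Holds (Cond.subst σ c) → t.subst σ = t'.subst σ

/-- `σ` is a solution of `S` relative to `Sg`. -/
def Solves (Sg : SubclassRel) (S : Set Constraint) (σ : Subst) : Prop := ∀ s ∈ S, Sat Sg σ s

/-- A class table satisfies a (ground) class requirement. -/
def SatisfiesReq (CT : ClassTable) : CReq → Prop
  | .ext t t' => ∃ C D, t = .cls C ∧ t' = .cls D ∧ Extends CT C D
  | .ctor t ts => ∃ C Ds, t = .cls C ∧ ts = Ds.map Ty.cls ∧ Fields CT C Ds
  | .field t f t' => ∃ C D, t = .cls C ∧ t' = .cls D ∧ FieldLookup CT f C D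
  | .meth t m ts t' =>
      ∃ C Ds D, t = .cls C ∧ ts = Ds.map Ty.cls ∧ t' = .cls D ∧ MType CT m C Ds D
  | .optMeth t m ts t' =>
      ∃ C, t = .cls C ∧ ∀ Ds D, MType CT m C Ds D → ts = Ds.map Ty.cls ∧ t' = .cls D

/-- A class table satisfies (ground) class table requirements: it satisfies those whose condition
holds. -/
def Satisfies (CT : ClassTable) (CR : ClassReqs) : Prop :=
  ∀ r ∈ CR, Cond.Holds r.2 → SatisfiesReq CT r.1

/-- The superclasses that (ground) class table requirements ask for are the ones given by `Sg`. -/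
def InheritanceIn (Sg : SubclassRel) (CR : ClassReqs) : Prop :=
  ∀ r ∈ CR, Cond.Holds r.2 → ∀ C D, r.1 = .ext (.cls C) (.cls D) → (C, D) ∈ Sg

end CoFJ

/-!
Every requirement is declared in its receiver class itself, optional method requirements included,
so that lookup never has to go to a superclass. Merging only changes conditions: up to the
conditions, the merged requirements are the union of the given ones. Hence a class table that
declares all requirements of a method, whether or not their conditions hold, declares the ones
introduced in each typing rule, and co-contextual derivations turn into contextual ones.

Such a class table is consistent because the constraints of a merge compare the signatures of all
overlapping requirements with equal receivers, again regardless of their conditions. That it has no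
other superclasses than the required ones holds because merging never falsifies all conditions on
the requirements on a member of a class: of two requirements whose conditions hold, either both
survive (different receivers) or they become one (equal receivers).
-/

namespace CoFJ

/-! ### Solutions -/

section Solves

variable {Sg : SubclassRel} {σ : Subst}

theorem solves_union {S S' : Set Constraint} :
    Solves Sg (S ∪ S') σ ↔ Solves Sg S σ ∧ Solves Sg S' σ := by
  simp only [Solves, Set.mem_union, or_imp, forall_and]

theorem solves_singleton {s : Constraint} : Solves Sg {s} σ ↔ Sat Sg σ s := by
  simp [Solves]

theorem Solves.of_mem_allCons {os : List Output} (h : Solves Sg (allCons os) σ) {o : Output}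
    (ho : o ∈ os) : Solves Sg o.cons σ :=
  fun s hs => h s ⟨o, ho, hs⟩

theorem forall₂_sub_of_solves_argCons {os : List Output} {Us : List ClassVar}
    (hl : os.length = Us.length) (h : Solves Sg (argCons os Us) σ) :
    List.Forall₂ (Ty.Sub Sg) (os.map fun o => o.ty.subst σ)
      ((Us.map Ty.var).map (Ty.subst σ)) := by
  rw [List.map_map, List.forall₂_map_left_iff, List.forall₂_map_right_iff, List.forall₂_iff_zip]
  exact ⟨hl, fun hp => h _ ⟨_, hp, rfl⟩⟩

theorem map_subst_eq_of_solves_seqEqIf {ts ts' : List Ty} {t t' : Ty}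
    (h : Solves Sg (seqEqIf ts ts' t t') σ) (ht : t.subst σ = t'.subst σ) :
    ts.map (Ty.subst σ) = ts'.map (Ty.subst σ) := by
  unfold seqEqIf at h
  split_ifs at h with hl
  · rw [← List.forall₂_eq_eq_eq, List.forall₂_map_left_iff, List.forall₂_map_right_iff,
      List.forall₂_iff_zip]
    refine ⟨hl, fun hp => h _ ⟨_, hp, rfl⟩ ?_⟩
    simpa [Cond.Holds, Cond.subst, CondAtom.subst, CondAtom.Holds] using ht
  · exact absurd ht (solves_singleton.1 h)

end Solves

/-! ### Requirements and merging -/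

/-- A member of a class: the receiver, which need not be ground, and the entry in question. -/
abbrev Member := Ty × MemberKey

/-- The member that a requirement is about. -/
def CReq.member (r : CReq) : Member := (r.recv, r.key)

/-- The requirements in `σ(A)`, whether or not their conditions hold. -/
def ClassReqs.required (σ : Subst) (A : ClassReqs) : Finset CReq := A.image fun a => a.1.subst σ

/-- The members that the requirements in `σ(A)` whose conditions hold are about. -/
def ClassReqs.activeMembers (σ : Subst) (A : ClassReqs) : Set Member :=
  {p | ∃ a ∈ A, (Cond.subst σ a.2).Holds ∧ (a.1.subst σ).member = p}

/-- All requirements on a member ask for the same signature. -/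
def Coherent (R : Finset CReq) : Prop :=
  ∀ r ∈ R, ∀ r' ∈ R, r.member = r'.member → r.signature = r'.signature

/-- Every requirement in `σ(A)` is accompanied by one on the same member whose condition holds. -/
def Enforced (σ : Subst) (A : ClassReqs) : Prop :=
  ∀ r ∈ A.required σ, r.member ∈ A.activeMembers σ

/-- The invariant of merging: when conditions are ignored, `σ(A)` neither contradicts itself nor
asks for members that it does not ask for with the conditions. -/
structure Resolved (σ : Subst) (A : ClassReqs) : Prop where
  coherent : Coherent (A.required σ)
  enforced : Enforced σ A

theorem CReq.member_subst (σ : Subst) (r : CReq) :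
    (r.subst σ).member = (r.recv.subst σ, r.key) := by
  cases r <;> rfl

theorem CReq.signature_subst (σ : Subst) (r : CReq) :
    (r.subst σ).signature = r.signature.map (Ty.subst σ) := by
  cases r <;> rfl

theorem CReq.keep_eq_or (r r' : CReq) : r.keep r' = r ∨ r.keep r' = r' := by
  cases r <;> cases r' <;> simp [CReq.keep]

theorem Cond.holds_subst_insert {σ : Subst} {x : CondAtom} {c : Cond} :
    (Cond.subst σ (insert x c)).Holds ↔ (x.subst σ).Holds ∧ (Cond.subst σ c).Holds := by
  simp [Cond.Holds, Cond.subst]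

theorem Cond.holds_subst_union {σ : Subst} {c c' : Cond} :
    (Cond.subst σ (c ∪ c')).Holds ↔ (Cond.subst σ c).Holds ∧ (Cond.subst σ c').Holds := by
  simp [Cond.Holds, Cond.subst, or_imp, forall_and]

theorem mem_mergePair {a b x : CReq × Cond} :
    x ∈ mergePair a b ↔ x = (a.1, insert (.neq a.1.recv b.1.recv) a.2) ∨
      x = (b.1, insert (.neq a.1.recv b.1.recv) b.2) ∨
      x = (a.1.keep b.1, insert (.eq a.1.recv b.1.recv) (a.2 ∪ b.2)) := by
  simp [mergePair]

section Merge

variable {Sg : SubclassRel} {σ : Subst} {A B : ClassReqs}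

theorem mem_mergeCR {x : CReq × Cond} :
    x ∈ mergeCR A B ↔ (x ∈ A ∧ ∀ b ∈ B, x.1.key ≠ b.1.key) ∨
      (x ∈ B ∧ ∀ a ∈ A, a.1.key ≠ x.1.key) ∨
      ∃ a ∈ A, ∃ b ∈ B, a.1.key = b.1.key ∧ x ∈ mergePair a b := by
  simp only [mergeCR, Finset.mem_union, Finset.mem_filter, Finset.mem_biUnion, Finset.mem_product,
    Prod.exists]
  grind

theorem mem_mergeCR_of_mem_mergePair {a b x : CReq × Cond} (ha : a ∈ A) (hb : b ∈ B)
    (hk : a.1.key = b.1.key) (hx : x ∈ mergePair a b) : x ∈ mergeCR A B :=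
  mem_mergeCR.2 (.inr (.inr ⟨a, ha, b, hb, hk, hx⟩))

theorem subst_mem_required {a : CReq × Cond} (ha : a ∈ A) : a.1.subst σ ∈ A.required σ :=
  Finset.mem_image_of_mem _ ha

@[simp]
theorem required_empty : ClassReqs.required σ ∅ = ∅ :=
  rfl

@[simp]
theorem required_singleton (r : CReq) (c : Cond) :
    ClassReqs.required σ {(r, c)} = {r.subst σ} :=
  rfl

theorem forall_mem_required_singleton {r : CReq} {c : Cond} {P : CReq → Prop} :
    (∀ r' ∈ ClassReqs.required σ {(r, c)}, P r') ↔ P (r.subst σ) := by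
  simp only [required_singleton, Finset.mem_singleton, forall_eq]

theorem image_fst_mergeCR :
    (mergeCR A B).image Prod.fst = A.image Prod.fst ∪ B.image Prod.fst := by
  ext r
  simp only [Finset.mem_union, Finset.mem_image]
  constructor
  · rintro ⟨x, hx, rfl⟩
    rcases mem_mergeCR.1 hx with ⟨hx, -⟩ | ⟨hx, -⟩ | ⟨a, ha, b, hb, -, hx⟩
    · exact .inl ⟨x, hx, rfl⟩
    · exact .inr ⟨x, hx, rfl⟩
    · rcases mem_mergePair.1 hx with rfl | rfl | rfl
      · exact .inl ⟨a, ha, rfl⟩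
      · exact .inr ⟨b, hb, rfl⟩
      · exact (a.1.keep_eq_or b.1).imp (fun h => ⟨a, ha, h.symm⟩) fun h => ⟨b, hb, h.symm⟩
  · rintro (⟨a, ha, rfl⟩ | ⟨b, hb, rfl⟩)
    · by_cases! hk : ∀ b ∈ B, a.1.key ≠ b.1.key
      · exact ⟨a, mem_mergeCR.2 (.inl ⟨ha, hk⟩), rfl⟩
      · obtain ⟨b, hb, hk⟩ := hk
        exact ⟨_, mem_mergeCR_of_mem_mergePair ha hb hk (mem_mergePair.2 (.inl rfl)), rfl⟩
    · by_cases! hk : ∀ a ∈ A, a.1.key ≠ b.1.key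
      · exact ⟨b, mem_mergeCR.2 (.inr (.inl ⟨hb, hk⟩)), rfl⟩
      · obtain ⟨a, ha, hk⟩ := hk
        exact ⟨_, mem_mergeCR_of_mem_mergePair ha hb hk (mem_mergePair.2 (.inr (.inl rfl))), rfl⟩

theorem required_mergeCR : (mergeCR A B).required σ = A.required σ ∪ B.required σ := by
  have required_eq (A : ClassReqs) : A.required σ = (A.image Prod.fst).image (CReq.subst σ) := by
    rw [Finset.image_image]
    rfl
  simp only [required_eq, image_fst_mergeCR, Finset.image_union]

theorem signature_eq_of_solves_mergeCRConstraints (h : Solves Sg (mergeCRConstraints A B) σ)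
    {r r' : CReq} (hr : r ∈ A.required σ) (hr' : r' ∈ B.required σ)
    (hm : r.member = r'.member) : r.signature = r'.signature := by
  obtain ⟨a, ha, rfl⟩ := Finset.mem_image.1 hr
  obtain ⟨b, hb, rfl⟩ := Finset.mem_image.1 hr'
  simp only [CReq.member_subst, Prod.mk.injEq] at hm
  simp only [CReq.signature_subst]
  exact map_subst_eq_of_solves_seqEqIf (fun s hs => h s ⟨a, ha, b, hb, hm.2, hs⟩) hm.1

theorem Coherent.mergeCR (hA : Coherent (A.required σ)) (hB : Coherent (B.required σ))
    (h : Solves Sg (mergeCRConstraints A B) σ) : Coherent ((mergeCR A B).required σ) := by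
  intro r hr r' hr' hm
  rw [required_mergeCR, Finset.mem_union] at hr hr'
  rcases hr with hr | hr <;> rcases hr' with hr' | hr'
  · exact hA r hr r' hr' hm
  · exact signature_eq_of_solves_mergeCRConstraints h hr hr' hm
  · exact (signature_eq_of_solves_mergeCRConstraints h hr' hr hm.symm).symm
  · exact hB r hr r' hr' hm

theorem mem_activeMembers_mergeCR_of_mem_of_mem {p : Member} (hA : p ∈ A.activeMembers σ)
    (hB : p ∈ B.activeMembers σ) : p ∈ (mergeCR A B).activeMembers σ := by
  obtain ⟨a, ha, hac, rfl⟩ := hA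
  obtain ⟨b, hb, hbc, hm⟩ := hB
  have hab := hm
  simp only [CReq.member_subst, Prod.mk.injEq] at hab
  refine ⟨(a.1.keep b.1, insert (.eq a.1.recv b.1.recv) (a.2 ∪ b.2)),
    mem_mergeCR_of_mem_mergePair ha hb hab.2.symm (mem_mergePair.2 (.inr (.inr rfl))),
    (Cond.holds_subst_insert (x := .eq _ _)).2
      ⟨hab.1.symm, Cond.holds_subst_union.2 ⟨hac, hbc⟩⟩, ?_⟩
  rcases a.1.keep_eq_or b.1 with h | h
  · simp only [h]
  · simp only [h, hm]

theorem activeMembers_subset_mergeCR_left (hB : Enforced σ B) :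
    A.activeMembers σ ⊆ (mergeCR A B).activeMembers σ := by
  rintro _ ⟨a, ha, hac, rfl⟩
  by_cases! hk : ∀ b ∈ B, a.1.key ≠ b.1.key
  · exact ⟨a, mem_mergeCR.2 (.inl ⟨ha, hk⟩), hac, rfl⟩
  obtain ⟨b, hb, hk⟩ := hk
  by_cases hr : a.1.recv.subst σ = b.1.recv.subst σ
  · have hm : (a.1.subst σ).member = (b.1.subst σ).member := by
      simp only [CReq.member_subst, hr, hk]
    exact mem_activeMembers_mergeCR_of_mem_of_mem ⟨a, ha, hac, rfl⟩
      (hm ▸ hB _ (subst_mem_required hb))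
  · exact ⟨_, mem_mergeCR_of_mem_mergePair ha hb hk (mem_mergePair.2 (.inl rfl)),
      Cond.holds_subst_insert.2 ⟨hr, hac⟩, rfl⟩

theorem activeMembers_subset_mergeCR_right (hA : Enforced σ A) :
    B.activeMembers σ ⊆ (mergeCR A B).activeMembers σ := by
  rintro _ ⟨b, hb, hbc, rfl⟩
  by_cases! hk : ∀ a ∈ A, a.1.key ≠ b.1.key
  · exact ⟨b, mem_mergeCR.2 (.inr (.inl ⟨hb, hk⟩)), hbc, rfl⟩
  obtain ⟨a, ha, hk⟩ := hk
  by_cases hr : a.1.recv.subst σ = b.1.recv.subst σ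
  · have hm : (a.1.subst σ).member = (b.1.subst σ).member := by
      simp only [CReq.member_subst, hr, hk]
    exact mem_activeMembers_mergeCR_of_mem_of_mem (hm ▸ hA _ (subst_mem_required ha))
      ⟨b, hb, hbc, rfl⟩
  · exact ⟨_, mem_mergeCR_of_mem_mergePair ha hb hk (mem_mergePair.2 (.inr (.inl rfl))),
      Cond.holds_subst_insert.2 ⟨hr, hbc⟩, rfl⟩

theorem Enforced.mergeCR (hA : Enforced σ A) (hB : Enforced σ B) : Enforced σ (mergeCR A B) := by
  intro r hr
  rw [required_mergeCR, Finset.mem_union] at hr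
  exact hr.elim (fun hr => activeMembers_subset_mergeCR_left hB (hA r hr))
    fun hr => activeMembers_subset_mergeCR_right hA (hB r hr)

theorem Resolved.empty : Resolved σ ∅ := by
  constructor <;> simp [Coherent, Enforced]

theorem Resolved.singleton (r : CReq) : Resolved σ {(r, ∅)} := by
  constructor <;>
    simp [Coherent, Enforced, ClassReqs.activeMembers, Cond.Holds, Cond.subst]

theorem Resolved.mergeCR (hA : Resolved σ A) (hB : Resolved σ B)
    (h : Solves Sg (mergeCRConstraints A B) σ) : Resolved σ (mergeCR A B) :=
  ⟨hA.coherent.mergeCR hB.coherent h, hA.enforced.mergeCR hB.enforced⟩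

theorem Resolved.mergeCRFrom {Bs : List ClassReqs} (hA : Resolved σ A)
    (hBs : ∀ B ∈ Bs, Resolved σ B) (h : Solves Sg (mergeCRFrom A Bs).2 σ) :
    Resolved σ (mergeCRFrom A Bs).1 := by
  induction Bs generalizing A with
  | nil => exact hA
  | cons B Bs ih =>
    rw [List.forall_mem_cons] at hBs
    obtain ⟨hAB, h⟩ := solves_union.1 h
    exact ih (hA.mergeCR hBs.1 hAB) hBs.2 h

theorem Resolved.mergeCRs {Bs : List ClassReqs} (hBs : ∀ B ∈ Bs, Resolved σ B)
    (h : Solves Sg (mergeCRs Bs).2 σ) : Resolved σ (mergeCRs Bs).1 :=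
  Resolved.empty.mergeCRFrom hBs h

theorem mem_required_mergeCRFrom {Bs : List ClassReqs} {r : CReq} :
    r ∈ (mergeCRFrom A Bs).1.required σ ↔ r ∈ A.required σ ∨ ∃ B ∈ Bs, r ∈ B.required σ := by
  induction Bs generalizing A with
  | nil => simp [mergeCRFrom]
  | cons B Bs ih => simp [mergeCRFrom, ih, required_mergeCR, or_assoc]

theorem forall_mem_required_mergeCRs {Bs : List ClassReqs} {P : CReq → Prop} :
    (∀ r ∈ (mergeCRs Bs).1.required σ, P r) ↔ ∀ B ∈ Bs, ∀ r ∈ B.required σ, P r := by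
  simp only [mergeCRs, mem_required_mergeCRFrom, required_empty, Finset.notMem_empty, false_or]
  grind

end Merge

theorem forall_mem_of_forall_mem_zip {α β : Type*} {as : List α} {bs : List β} {P : β → Prop}
    (hl : as.length = bs.length) (h : ∀ p ∈ as.zip bs, P p.2) : ∀ b ∈ bs, P b := by
  rw [← List.map_snd_zip hl.ge]
  exact List.forall_mem_map.2 h

theorem CoExpr.resolved {Sg : SubclassRel} {σ : Subst} {e : Expr} {o : Output}
    (he : CoExpr e o) (h : Solves Sg o.cons σ) : Resolved σ o.creqs := by
  have args {es : List Expr} {os : List Output} (hl : es.length = os.length)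
      (ihs : ∀ p ∈ es.zip os, Solves Sg p.2.cons σ → Resolved σ p.2.creqs)
      (hos : Solves Sg (allCons os) σ) : ∀ A ∈ os.map Output.creqs, Resolved σ A :=
    List.forall_mem_map.2 fun o ho => forall_mem_of_forall_mem_zip
      (P := fun o => Solves Sg o.cons σ → Resolved σ o.creqs) hl ihs o ho (hos.of_mem_allCons ho)
  induction he with
  | ref => exact .empty
  | field _ _ ih =>
    obtain ⟨ho, hmerge⟩ := solves_union.1 h
    exact .mergeCRs (by simpa using ⟨ih ho, .singleton _⟩) hmerge
  | invk _ hl _ _ _ _ _ hcrs ih ihs =>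
    subst hcrs
    simp only [solves_union] at h
    obtain ⟨⟨⟨⟨hos, ho⟩, -⟩, -⟩, hmerge⟩ := h
    refine .mergeCRs ?_ hmerge
    simp only [List.forall_mem_cons]
    exact ⟨ih ho, .singleton _, args hl ihs hos⟩
  | new hl _ _ _ _ _ hcrs ihs =>
    subst hcrs
    simp only [solves_union] at h
    obtain ⟨⟨⟨hos, -⟩, -⟩, hmerge⟩ := h
    refine .mergeCRs ?_ hmerge
    simp only [List.forall_mem_cons]
    exact ⟨.singleton _, args hl ihs hos⟩
  | ucast _ ih => exact ih (solves_union.1 h).1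
  | dcast _ ih => exact ih (solves_union.1 (solves_union.1 h).1).1
  | scast _ ih => exact ih (solves_union.1 (solves_union.1 h).1).1

theorem CoMethod.resolved {Sg : SubclassRel} {σ : Subst} {M : MethodDecl} {S : Set Constraint}
    {T : Ty} {CR : ClassReqs} (hM : CoMethod M S T CR) (h : Solves Sg S σ) : Resolved σ CR := by
  obtain ⟨he, -, -, -, -, rfl⟩ := hM
  simp only [solves_union] at h
  obtain ⟨⟨⟨⟨ho, -⟩, -⟩, hmerge⟩, -⟩ := h
  exact .mergeCRs (by simpa using ⟨he.resolved ho, .singleton _, .singleton _⟩) hmerge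

/-! ### Class tables that declare requirements -/

/-- The class name of a ground class type; a class variable gets a junk value. -/
def Ty.name : Ty → ClassName
  | .cls C => C
  | .var _ => default

/-- The clause that declares what a ground requirement asks for, in the receiver itself. -/
def CReq.toClause : CReq → Clause
  | .ext t t' => .ext t.name t'.name
  | .ctor t ts => .ctor t.name (ts.map Ty.name)
  | .field t f t' => .field t.name f t'.name
  | .meth t m ts t' => .meth t.name m (ts.map Ty.name) t'.name
  | .optMeth t m ts t' => .meth t.name m (ts.map Ty.name) t'.name

/-- The member that a clause declares. -/
def Clause.member : Clause → Member
  | .ext C _ => (.cls C, .ext)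
  | .ctor C _ => (.cls C, .ctor)
  | .field C f _ => (.cls C, .field f)
  | .meth C m _ _ => (.cls C, .meth m)

/-- The requirement `r` is ground and met by a clause for its receiver itself, without going to a
superclass. An optional method counts as declared only if it is there. -/
def Declares (CT : ClassTable) (r : CReq) : Prop := r.Ground ∧ r.toClause ∈ CT

theorem Ty.Ground.cls_name {t : Ty} (h : t.Ground) : Ty.cls t.name = t := by
  obtain ⟨C, rfl⟩ := h
  rfl

theorem map_cls_map_name {ts : List Ty} (h : ∀ t ∈ ts, t.Ground) :
    (ts.map Ty.name).map Ty.cls = ts := by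
  rw [List.map_map]
  exact (List.map_congr_left fun t ht => (h t ht).cls_name).trans (List.map_id _)

theorem CReq.Ground.member_toClause {r : CReq} (h : r.Ground) :
    r.toClause.member = r.member := by
  have hr : Ty.cls r.recv.name = r.recv := h.1.cls_name
  cases r <;> exact congrArg (·, _) hr

theorem CReq.toClause_eq_toClause {r r' : CReq} (hm : r.member = r'.member)
    (hs : r.signature = r'.signature) : r.toClause = r'.toClause := by
  cases r <;> cases r' <;>
    simp_all [CReq.member, CReq.recv, CReq.key, CReq.signature, CReq.toClause]

theorem CReq.eq_ext {r : CReq} {t t' : Ty} (hm : r.member = (t, .ext))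
    (hs : r.signature = [t']) : r = .ext t t' := by
  cases r <;> simp_all [CReq.member, CReq.recv, CReq.key, CReq.signature]

theorem mem_extRel {CT : ClassTable} {C D : ClassName} :
    (C, D) ∈ CT.extRel ↔ Clause.ext C D ∈ CT := by
  have mem_ext? (c : Clause) : (C, D) ∈ c.ext? ↔ c = .ext C D := by
    cases c <;> simp [Clause.ext?, eq_comm]
  simp [ClassTable.extRel, mem_ext?]

theorem ClassTable.Consistent.of_member {CT : ClassTable}
    (h : ∀ c ∈ CT, ∀ c' ∈ CT, c.member = c'.member → c.member.2 ≠ .ext → c = c') :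
    CT.Consistent where
  ctor _ _ _ hc hc' := (Clause.ctor.inj (h _ hc _ hc' rfl nofun)).2
  field _ _ _ _ hc hc' := (Clause.field.inj (h _ hc _ hc' rfl nofun)).2.2
  meth _ _ _ _ _ _ hc hc' := (Clause.meth.inj (h _ hc _ hc' rfl nofun)).2.2

theorem ClassTable.Consistent.mtype_unique {CT : ClassTable} (h : CT.Consistent)
    {m : MethodName} {C D D' : ClassName} {Ds Ds' : List ClassName}
    (hc : Clause.meth C m Ds D ∈ CT) (ht : MType CT m C Ds' D') : Ds = Ds' ∧ D = D' := by
  cases ht with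
  | here hc' => exact h.meth _ _ _ _ _ _ hc hc'
  | up hnone => exact absurd hc (hnone _ _)


theorem Declares.satisfiesReq {CT : ClassTable} (hCT : CT.Consistent) {r : CReq}
    (h : Declares CT r) : SatisfiesReq CT r := by
  obtain ⟨⟨hrecv, hsig⟩, hc⟩ := h
  have hrecv := hrecv.cls_name.symm
  cases r with
  | ext t t' => exact ⟨_, _, hrecv, (hsig t' (by simp [CReq.signature])).cls_name.symm, hc⟩
  | ctor t ts => exact ⟨_, _, hrecv, (map_cls_map_name hsig).symm, hc⟩
  | field t f t' =>
    exact ⟨_, _, hrecv, (hsig t' (by simp [CReq.signature])).cls_name.symm, .here hc⟩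
  | meth t m ts t' =>
    obtain ⟨ht', hts⟩ := List.forall_mem_cons.1 hsig
    exact ⟨_, _, _, hrecv, (map_cls_map_name hts).symm, ht'.cls_name.symm, .here hc⟩
  | optMeth t m ts t' =>
    obtain ⟨ht', hts⟩ := List.forall_mem_cons.1 hsig
    refine ⟨_, hrecv, fun Ds D hD => ?_⟩
    obtain ⟨rfl, rfl⟩ := hCT.mtype_unique hc hD
    exact ⟨(map_cls_map_name hts).symm, ht'.cls_name.symm⟩

/-- The class table with the immediate subclass relation `Sg` that declares all requirements in
`R`. Optional methods are declared as well, since the class might otherwise inherit a method of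
the same name with another signature. -/
def tableOf (Sg : SubclassRel) (R : Finset CReq) : ClassTable :=
  Sg.image (fun p => Clause.ext p.1 p.2) ∪ R.image CReq.toClause

section TableOf

variable {Sg : SubclassRel} {R : Finset CReq}

theorem mem_tableOf {c : Clause} :
    c ∈ tableOf Sg R ↔ (∃ C D, (C, D) ∈ Sg ∧ c = .ext C D) ∨ ∃ r ∈ R, r.toClause = c := by
  simp [tableOf, eq_comm]

theorem declares_tableOf {r : CReq} (hr : r ∈ R) (hg : r.Ground) : Declares (tableOf Sg R) r :=
  ⟨hg, mem_tableOf.2 (.inr ⟨r, hr, rfl⟩)⟩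

theorem extRel_tableOf (hR : ∀ r ∈ R, r.Ground)
    (hext : ∀ C D, .ext (.cls C) (.cls D) ∈ R → (C, D) ∈ Sg) : (tableOf Sg R).extRel = Sg := by
  ext ⟨C, D⟩
  rw [mem_extRel, mem_tableOf]
  constructor
  · rintro (⟨C, D, hCD, ⟨⟩⟩ | ⟨r, hr, hc⟩)
    · exact hCD
    · cases r with
      | ext t t' =>
        obtain ⟨rfl, rfl⟩ := Clause.ext.inj hc
        have ht : t.Ground := (hR _ hr).1
        have ht' : t'.Ground := (hR _ hr).2 t' (by simp [CReq.signature])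
        exact hext _ _ (by rwa [ht.cls_name, ht'.cls_name])
      | _ => cases hc
  · exact fun hCD => .inl ⟨C, D, hCD, rfl⟩

theorem consistent_tableOf (hR : ∀ r ∈ R, r.Ground) (hcoh : Coherent R) :
    (tableOf Sg R).Consistent := by
  have eq_toClause {c : Clause} (hc : c ∈ tableOf Sg R) (hne : c.member.2 ≠ .ext) :
      ∃ r ∈ R, r.toClause = c :=
    (mem_tableOf.1 hc).resolve_left fun ⟨C, D, _, h⟩ => hne (h ▸ rfl)
  refine .of_member fun c hc c' hc' hm hne => ?_
  obtain ⟨r, hr, rfl⟩ := eq_toClause hc hne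
  obtain ⟨r', hr', rfl⟩ := eq_toClause hc' (hm ▸ hne)
  rw [(hR r hr).member_toClause, (hR r' hr').member_toClause] at hm
  exact CReq.toClause_eq_toClause hm (hcoh r hr r' hr' hm)

end TableOf

section Required

variable {σ : Subst} {CR : ClassReqs}

theorem ground_of_mem_required (hCR : (CR.subst σ).Ground) {r : CReq} (hr : r ∈ CR.required σ) :
    r.Ground := by
  obtain ⟨a, ha, rfl⟩ := Finset.mem_image.1 hr
  exact (hCR _ (Finset.mem_image_of_mem _ ha)).1

theorem satisfies_subst_of_declares {CT : ClassTable} (hCT : CT.Consistent)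
    (h : ∀ r ∈ CR.required σ, Declares CT r) : Satisfies CT (CR.subst σ) := by
  intro r hr _
  obtain ⟨a, ha, rfl⟩ := Finset.mem_image.1 hr
  exact (h _ (subst_mem_required ha)).satisfiesReq hCT

theorem Resolved.ext_mem {Sg : SubclassRel} (h : Resolved σ CR)
    (hext : InheritanceIn Sg (CR.subst σ)) {C D : ClassName}
    (hr : .ext (.cls C) (.cls D) ∈ CR.required σ) : (C, D) ∈ Sg := by
  obtain ⟨a, ha, hac, hm⟩ := h.enforced _ hr
  have hs := h.coherent _ (subst_mem_required ha) _ hr hm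
  exact hext _ (Finset.mem_image_of_mem _ ha) hac C D (CReq.eq_ext hm hs)

end Required

/-! ### From co-contextual to contextual typing -/

/-- Contextual typing with a class type in place of a class name. -/
def HasGroundType (CT : ClassTable) (Γ : Ctx) (e : Expr) (t : Ty) : Prop :=
  t.Ground ∧ HasType CT Γ e t.name

theorem Ty.Sub.isSubtype_name {Sg : SubclassRel} {t t' : Ty} (h : Ty.Sub Sg t t') :
    IsSubtype Sg t.name t'.name := by
  obtain ⟨C, D, rfl, rfl, h⟩ := h
  exact h

theorem forall₂_isSubtype_map_name {Sg : SubclassRel} {ts ts' : List Ty}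
    (h : List.Forall₂ (Ty.Sub Sg) ts ts') :
    List.Forall₂ (IsSubtype Sg) (ts.map Ty.name) (ts'.map Ty.name) := by
  rw [List.forall₂_map_left_iff, List.forall₂_map_right_iff]
  exact h.imp fun _ _ h => h.isSubtype_name

namespace HasGroundType

variable {CT : ClassTable} {Γ : Ctx} {e : Expr} {es : List Expr} {C : ClassName} {t t' : Ty}
  {ts ts' : List Ty} {m : MethodName}

theorem forall₂_hasType (h : List.Forall₂ (HasGroundType CT Γ) es ts) :
    List.Forall₂ (HasType CT Γ) es (ts.map Ty.name) :=
  List.forall₂_map_right_iff.2 (h.imp fun _ _ h => h.2)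

theorem field {f : FieldName} (h : HasGroundType CT Γ e t) (hf : Declares CT (.field t f t')) :
    HasGroundType CT Γ (.field e f) t' :=
  ⟨hf.1.2 t' (by simp [CReq.signature]), .field h.2 (.here hf.2)⟩

theorem invk (h : HasGroundType CT Γ e t) (hs : List.Forall₂ (HasGroundType CT Γ) es ts)
    (hsub : List.Forall₂ (Ty.Sub CT.extRel) ts ts') (hm : Declares CT (.meth t m ts' t')) :
    HasGroundType CT Γ (.invk e m es) t' :=
  ⟨hm.1.2 t' (by simp [CReq.signature]), .invk h.2 (forall₂_hasType hs).length_eq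
    (fun _ => List.forall₂_zip (forall₂_hasType hs)) (.here hm.2) (forall₂_isSubtype_map_name hsub)⟩

theorem new (hs : List.Forall₂ (HasGroundType CT Γ) es ts)
    (hsub : List.Forall₂ (Ty.Sub CT.extRel) ts ts') (hc : Declares CT (.ctor (.cls C) ts')) :
    HasGroundType CT Γ (.new C es) (.cls C) :=
  ⟨⟨C, rfl⟩, .new (forall₂_hasType hs).length_eq (fun _ => List.forall₂_zip (forall₂_hasType hs))
    hc.2 (forall₂_isSubtype_map_name hsub)⟩

theorem ucast (h : HasGroundType CT Γ e t) (hsub : Ty.Sub CT.extRel t (.cls C)) :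
    HasGroundType CT Γ (.cast C e) (.cls C) :=
  ⟨⟨C, rfl⟩, .ucast h.2 hsub.isSubtype_name⟩

theorem dcast (h : HasGroundType CT Γ e t) (hsub : Ty.Sub CT.extRel (.cls C) t)
    (hne : .cls C ≠ t) : HasGroundType CT Γ (.cast C e) (.cls C) :=
  ⟨⟨C, rfl⟩, .dcast h.2 hsub.isSubtype_name fun hC => hne (hC ▸ h.1.cls_name)⟩

theorem scast (h : HasGroundType CT Γ e t) (hnsub : ¬ Ty.Sub CT.extRel (.cls C) t)
    (hnsub' : ¬ Ty.Sub CT.extRel t (.cls C)) : HasGroundType CT Γ (.cast C e) (.cls C) :=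
  ⟨⟨C, rfl⟩, .scast h.2 (fun hs => hnsub ⟨_, _, rfl, h.1.cls_name.symm, hs⟩)
    fun hs => hnsub' ⟨_, _, h.1.cls_name.symm, rfl, hs⟩⟩

end HasGroundType

/-- The context `Γ` assigns the types in `σ(R)`. -/
def Meets (σ : Subst) (Γ : Ctx) (R : CtxReqs) : Prop :=
  ∀ x t, R x = some t → ∃ C, Γ x = some C ∧ t.subst σ = .cls C

section Meets

variable {Sg : SubclassRel} {σ : Subst} {Γ : Ctx} {R R' : CtxReqs}

theorem Meets.of_mergeR (h : Meets σ Γ (mergeR R R')) (hc : Solves Sg (mergeRConstraints R R') σ) :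
    Meets σ Γ R ∧ Meets σ Γ R' := by
  have left : Meets σ Γ R := fun x t ht => h x t (by simp [mergeR, ht])
  refine ⟨left, fun x t ht => ?_⟩
  cases hx : R x with
  | none => exact h x t (by simp [mergeR, hx, ht])
  | some t₀ =>
    obtain ⟨C, hC, ht₀⟩ := left x t₀ hx
    exact ⟨C, hC, (hc (.eq t₀ t) ⟨x, t₀, t, hx, ht, rfl⟩).symm.trans ht₀⟩

theorem Meets.of_mergeRFrom {Rs : List CtxReqs} (h : Meets σ Γ (mergeRFrom R Rs).1)
    (hc : Solves Sg (mergeRFrom R Rs).2 σ) : Meets σ Γ R ∧ ∀ R' ∈ Rs, Meets σ Γ R' := by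
  induction Rs generalizing R with
  | nil => exact ⟨h, nofun⟩
  | cons R' Rs ih =>
    obtain ⟨hRR', hc⟩ := solves_union.1 hc
    obtain ⟨hR, hRs⟩ := ih h hc
    obtain ⟨hR, hR'⟩ := hR.of_mergeR hRR'
    exact ⟨hR, List.forall_mem_cons.2 ⟨hR', hRs⟩⟩

theorem Meets.of_mergeRs {Rs : List CtxReqs} (h : Meets σ Γ (mergeRs Rs).1)
    (hc : Solves Sg (mergeRs Rs).2 σ) : ∀ R ∈ Rs, Meets σ Γ R :=
  (h.of_mergeRFrom hc).2

theorem meets_ctx {M : MethodDecl} {Uc : ClassVar} {C : ClassName} (hC : σ Uc = .cls C)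
    (hdom : ∀ x, R (.param x) ≠ none → x ∈ M.params.map Prod.fst)
    (hthis : Solves Sg (thisCons Uc R) σ) (hparams : Solves Sg (paramCons M R) σ) :
    Meets σ (M.ctx C) R := by
  rintro (_ | x) t ht
  · exact ⟨C, rfl, (hthis (.eq (.var Uc) t) ⟨t, ht, rfl⟩).symm.trans hC⟩
  cases hx : M.params.lookup x with
  | none =>
    obtain ⟨p, hp, rfl⟩ := List.mem_map.1 (hdom x (by simp [ht]))
    exact absurd (List.lookup_eq_none_iff.1 hx p hp) (by simp)
  | some D =>
    obtain ⟨l, l', hl, -⟩ := List.lookup_eq_some_iff.1 hx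
    exact ⟨D, hx, (hparams (.eq (.cls D) t) ⟨(x, D), by simp [hl], t, ht, rfl⟩).symm⟩

end Meets

theorem forall₂_hasGroundType {CT : ClassTable} {σ : Subst} {Γ : Ctx} {es : List Expr}
    {os : List Output} (hl : es.length = os.length)
    (h : ∀ p ∈ es.zip os, Solves CT.extRel p.2.cons σ → Meets σ Γ p.2.reqs →
      (∀ r ∈ p.2.creqs.required σ, Declares CT r) → HasGroundType CT Γ p.1 (p.2.ty.subst σ))
    (hcons : Solves CT.extRel (allCons os) σ) (hreqs : ∀ R ∈ os.map Output.reqs, Meets σ Γ R)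
    (hcreqs : ∀ A ∈ os.map Output.creqs, ∀ r ∈ A.required σ, Declares CT r) :
    List.Forall₂ (HasGroundType CT Γ) es (os.map fun o => o.ty.subst σ) := by
  rw [List.forall₂_map_right_iff, List.forall₂_iff_zip]
  refine ⟨hl, fun hp => ?_⟩
  have ho := (List.of_mem_zip hp).2
  exact h _ hp (hcons.of_mem_allCons ho) (hreqs _ (List.mem_map_of_mem ho))
    (hcreqs _ (List.mem_map_of_mem ho))

theorem CoExpr.hasGroundType {CT : ClassTable} {σ : Subst} {Γ : Ctx} {e : Expr} {o : Output}
    (he : CoExpr e o) (hcons : Solves CT.extRel o.cons σ) (hreqs : Meets σ Γ o.reqs)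
    (hcreqs : ∀ r ∈ o.creqs.required σ, Declares CT r) :
    HasGroundType CT Γ e (o.ty.subst σ) := by
  induction he with
  | ref =>
    obtain ⟨C, hx, hC⟩ := hreqs _ _ (if_pos rfl)
    exact ⟨⟨C, hC⟩, .ref (by rw [hx, hC]; rfl)⟩
  | field _ _ ih =>
    obtain ⟨ho, -⟩ := solves_union.1 hcons
    simp only [forall_mem_required_mergeCRs, List.forall_mem_cons,
      forall_mem_required_singleton] at hcreqs
    obtain ⟨hcreqs, hf, -⟩ := hcreqs
    exact (ih ho hreqs hcreqs).field hf
  | invk _ hl _ _ hU _ _ hcrs ih ihs =>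
    subst hcrs
    simp only [solves_union] at hcons
    obtain ⟨⟨⟨⟨hos, ho⟩, hargs⟩, hmergeR⟩, -⟩ := hcons
    simp only [forall_mem_required_mergeCRs, List.forall_mem_cons,
      forall_mem_required_singleton] at hcreqs
    obtain ⟨hcreqs, hm, hcreqss⟩ := hcreqs
    obtain ⟨hreqs, hreqss⟩ := List.forall_mem_cons.1 (hreqs.of_mergeRs hmergeR)
    exact (ih ho hreqs hcreqs).invk (forall₂_hasGroundType hl ihs hos hreqss hcreqss)
      (forall₂_sub_of_solves_argCons (hl.symm.trans hU.symm) hargs) hm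
  | new hl _ _ hU _ _ hcrs ihs =>
    subst hcrs
    simp only [solves_union] at hcons
    obtain ⟨⟨⟨hos, hargs⟩, hmergeR⟩, -⟩ := hcons
    simp only [forall_mem_required_mergeCRs, List.forall_mem_cons,
      forall_mem_required_singleton] at hcreqs
    obtain ⟨hc, hcreqss⟩ := hcreqs
    exact .new (forall₂_hasGroundType hl ihs hos (hreqs.of_mergeRs hmergeR) hcreqss)
      (forall₂_sub_of_solves_argCons (hl.symm.trans hU.symm) hargs) hc
  | ucast _ ih =>
    simp only [solves_union, solves_singleton] at hcons
    exact (ih hcons.1 hreqs hcreqs).ucast hcons.2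
  | dcast _ ih =>
    simp only [solves_union, solves_singleton] at hcons
    exact (ih hcons.1.1 hreqs hcreqs).dcast hcons.1.2 hcons.2
  | scast _ ih =>
    simp only [solves_union, solves_singleton] at hcons
    exact (ih hcons.1.1 hreqs hcreqs).scast hcons.1.2 hcons.2

theorem CoMethod.methodOK {CT : ClassTable} {σ : Subst} {M : MethodDecl} {S : Set Constraint}
    {T : Ty} {CR : ClassReqs} {C : ClassName} (hM : CoMethod M S T CR) (hCT : CT.Consistent)
    (hS : Solves CT.extRel S σ) (hC : T.subst σ = .cls C)
    (hCR : ∀ r ∈ CR.required σ, Declares CT r) : MethodOK CT C M := by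
  obtain @⟨o, Uc, Ud, _, he, hdom, -, -, -, rfl⟩ := hM
  simp only [solves_union, solves_singleton] at hS
  obtain ⟨⟨⟨⟨ho, hret⟩, hthis⟩, -⟩, hparams⟩ := hS
  simp only [forall_mem_required_mergeCRs, List.forall_mem_cons,
    forall_mem_required_singleton] at hCR
  obtain ⟨hcreqs, hext, hmeth, -⟩ := hCR
  have hbody := he.hasGroundType ho (meets_ctx hC hdom hthis hparams) hcreqs
  have hUc : (σ Uc).name = C := congrArg Ty.name hC
  have hparamTypes : ((M.paramTypes.map Ty.cls).map (Ty.subst σ)).map Ty.name = M.paramTypes := by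
    rw [List.map_map, List.map_map]
    exact List.map_id _
  refine ⟨_, (σ Ud).name, hbody.2, hret.isSubtype_name, hUc ▸ hext.2, fun Ds D₀ hD => ?_⟩
  exact hparamTypes ▸ hCT.mtype_unique hmeth.2 hD

end CoFJ

theorem mainTheorem4 (M : CoFJ.MethodDecl) (T : CoFJ.Ty) (S : Set CoFJ.Constraint)
    (CR : CoFJ.ClassReqs) (Sg : CoFJ.SubclassRel) (σ : CoFJ.Subst)
    (hM : CoFJ.CoMethod M S T CR)
    (hσ : CoFJ.Solves Sg S σ)
    (hT : (T.subst σ).Ground)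
    (hCR : (CoFJ.ClassReqs.subst σ CR).Ground)
    (hext : CoFJ.InheritanceIn Sg (CoFJ.ClassReqs.subst σ CR)) :
    ∃ (C : CoFJ.ClassName) (CT : CoFJ.ClassTable),
      CT.Consistent ∧ CT.extRel = Sg ∧
      CoFJ.MethodOK CT C M ∧
      T.subst σ = .cls C ∧ CoFJ.Satisfies CT (CoFJ.ClassReqs.subst σ CR) := by
  open CoFJ in
  obtain ⟨C, hC⟩ := hT
  have hres : Resolved σ CR := hM.resolved hσ
  have hground : ∀ r ∈ CR.required σ, r.Ground := fun _ => ground_of_mem_required hCR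
  have hrel : (tableOf Sg (CR.required σ)).extRel = Sg :=
    extRel_tableOf hground fun _ _ => hres.ext_mem hext
  have hCT : (tableOf Sg (CR.required σ)).Consistent := consistent_tableOf hground hres.coherent
  have hdecl : ∀ r ∈ CR.required σ, Declares (tableOf Sg (CR.required σ)) r :=
    fun r hr => declares_tableOf hr (hground r hr)
  exact ⟨C, tableOf Sg (CR.required σ), hCT, hrel, hM.methodOK hCT (hrel.symm ▸ hσ) hC hdecl, hC,
    satisfies_subst_of_declares hCT hdecl⟩
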